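/- Let $T$ be a relation with $n\ge 2$ tuples and $d\ge 2$ real attributes, let $\epsilon>0$ and $0<\delta<1$. For tuples write $s\preceq t$ if $s.A_i\le t.A_i$ for all $i$, and $s\prec t$ if $s\preceq t$ and $s\ne t$. The skyline of a finite family of tuples consists of its tuples $t$ such that no tuple $s$ of the family satisfies $s\prec t$. **DOUBLE.** Let $s_I\ge 1$ be an initial sample size. (1) Put $m=s_I$, draw a sample $S$ of $m$ tuples of $T$, and compute its skyline, $\widetilde{Sky}=\mathrm{getSkyline}(S)$. (2) Verify: draw a sample $V$ of $s_v=\lceil 18(\ln\log_2 n+\ln\frac1\delta)/\epsilon\rceil$ tuples of $T$ and let $\hat\varepsilon$ be the proportion of tuples $t\in V$ for which no $s\in\widetilde{Sky}$ satisfies $s\preceq t$ (found by scanning $\widetilde{Sky}$ for each $t\in V$). (3) If $\hat\varepsilon\le\frac{2\epsilon}{3}$, return $\widetilde{Sky}$. Otherwise draw $m$ further tuples $S'$, replace $m$ by $2m$ and $\widetilde{Sky}$ by $\mathrm{mergeSkyline}(\widetilde{Sky},\mathrm{getSkyline}(S'))$, which is the skyline of the union of the two, and go back to (2). getSkyline is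 FLET: for $N$ input tuples, take the virtual point $x$ all of whose coordinates are $(\ln N/N)^{1/d}$; if some input tuple $s$ satisfies $s\preceq x$, discard all tuples dominated by $x$; run the presorted divide-and-conquer maxima algorithm (Kung–Luccio–Preparata) on what is left. mergeSkyline is FLET on the union of the two lists. The running time is the number of steps, where comparisons, list operations, arithmetic operations and random draws of a tuple cost one step each. **Theorem.** Let $m_q$ be the final value of $m$ in DOUBLE. (a) For fixed $d$ and $\epsilon$, DOUBLE runs in time $$O\Bigl(m_q\log^{d-1}m_q+\bigl(\ln\log_2 n+\ln\tfrac1\delta\bigr)\,m_q\log m_q\Bigr).$$ That is, for all $d\ge 2$ and $\epsilon>0$ there is a constant $C$ such that for all $n$, $T$, $\delta$, $s_I$ and all outcomes of the random draws for which DOUBLE returns with $m_q\ge 2$, its running time is at most $C\bigl(m_q\log_2^{d-1}m_q+(\ln\log_2 n+\ln\frac1\delta)m_q\log_2 m_q\bigr)$. (b) The dependence on $\epsilon$ is only through the size of the approximate skylines: for each $d\ge 2$ there is a constant $C$ such that for all $\epsilon$, $n$, $T$, $\delta$, $s_I$, all real $K$, and all outcomes of the random draws for which DOUBLE returns with $m_q\ge2$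 and every verified $\widetilde{Sky}$ has at most $K\epsilon m_q$ tuples, its running time is at most $C\bigl(m_q\log_2^{d-1}m_q+K(\ln\log_2 n+\ln\frac1\delta)m_q\log_2 m_q\bigr)$. -/

import Mathlib

namespace Skyline

/-! ### Cost model

A program is an element of `Timed α`: its result together with the number of steps it takes.
One step is charged for every comparison of two attribute values or two ranks, for every list cell
that is visited or created, and for every arithmetic operation or random draw of one tuple. -/

structure Timed (α : Type) where
  val : α
  cost : ℕ

instance : Monad Timed where
  pure a := ⟨a, 0⟩
  bind x f := ⟨(f x.val).val, x.cost + (f x.val).cost⟩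

def tick (k : ℕ) : Timed Unit := ⟨(), k⟩

/-- A tuple with `d` attributes. -/
abbrev Tuple (d : ℕ) (α : Type) := Fin d → α

section Comparisons

variable {d : ℕ} {α : Type} [LinearOrder α]

/-- Is `a i ≤ b i` for all the listed attributes `i`? -/
def leOn (a b : Tuple d α) : List (Fin d) → Timed Bool
  | [] => pure true
  | i :: is => do
    tick 1
    if a i ≤ b i then leOn a b is else pure false

/-- Test `a ⪯ b`, that is, `a` dominates `b` or equals `b`. -/
def weakDom (a b : Tuple d α) : Timed Bool := leOn a b (List.finRange d)

/-- Test `a = b`. -/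
def sameTuple (a b : Tuple d α) : Timed Bool := do
  if (← weakDom a b) then weakDom b a else pure false

/-- Test `a ≺ b`, that is, `a` dominates `b`. -/
def strictDom (a b : Tuple d α) : Timed Bool := do
  if (← weakDom a b) then
    let r ← weakDom b a
    pure (!r)
  else pure false

/-- Lexicographic comparison of `a` and `b` along a list of attributes. -/
def lexLE (a b : Tuple d α) : List (Fin d) → Timed Bool
  | [] => pure true
  | i :: is => do
    tick 2
    if a i < b i then pure true
    else if b i < a i then pure false
    else lexLE a b is

/-- Comparison by attribute `j`, ties broken lexicographically (a total order on tuples which, for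
every `j`, extends the dominance order). -/
def keyLE (j : Fin d) (a b : Tuple d α) : Timed Bool := lexLE a b (j :: List.finRange d)

end Comparisons

section Lists

variable {β γ : Type}

/-- Length of a list, one step per cell. -/
def lengthT : List β → Timed ℕ
  | [] => pure 0
  | _ :: xs => do
    tick 1
    let k ← lengthT xs
    pure (k + 1)

def mapT (f : β → γ) : List β → Timed (List γ)
  | [] => pure []
  | x :: xs => do
    tick 1
    let ys ← mapT f xs
    pure (f x :: ys)

def appendT : List β → List β → Timed (List β)
  | [], ys => pure ys
  | x :: xs, ys => do
    tick 1
    let zs ← appendT xs ys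
    pure (x :: zs)

/-- Merge two sorted lists. -/
def mergeT (le : β → β → Timed Bool) : List β → List β → Timed (List β)
  | [], ys => do tick 1; pure ys
  | x :: xs, [] => do tick 1; pure (x :: xs)
  | x :: xs, y :: ys => do
    tick 1
    if (← le x y) then
      let zs ← mergeT le xs (y :: ys)
      pure (x :: zs)
    else
      let zs ← mergeT le (x :: xs) ys
      pure (y :: zs)
termination_by xs ys => xs.length + ys.length

/-- Deal a list alternately into two lists. -/
def deal : List β → Timed (List β × List β)
  | [] => pure ([], [])
  | x :: xs => do
    tick 1
    let p ← deal xs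
    pure (x :: p.2, p.1)

/-- Merge sort of a list of length at most `2 ^ k`. -/
def mergeSortT (le : β → β → Timed Bool) : ℕ → List β → Timed (List β)
  | _, [] => do tick 1; pure []
  | _, [x] => do tick 1; pure [x]
  | 0, xs => do tick 1; pure xs
  | k + 1, xs => do
    tick 1
    let p ← deal xs
    let a ← mergeSortT le k p.1
    let b ← mergeSortT le k p.2
    mergeT le a b

end Lists

/-! ### The worst-case divide-and-conquer algorithm

The algorithm of Kung, Luccio and Preparata after presorting in every attribute. Presorting attaches
to each tuple its rank in each attribute; the sets are then halved according to ranks and are stored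
in the order of the last attribute, so that the two-attribute marriage step is a linear sweep. -/

/-- A tuple with its ranks; `rank j` is the rank of the tuple in the order `keyLE j`. Equal tuples
have equal ranks, different tuples have different ranks. -/
structure Item (d : ℕ) (α : Type) where
  tup : Tuple d α
  rank : ℕ → ℕ

section DivideConquer

variable {d : ℕ} {α : Type} [LinearOrder α]

/-- Record the ranks in attribute `j`, for a list sorted by `keyLE j`; `prev` is the preceding tuple
and `r` is its rank. -/
def assignRanksFrom (j : ℕ) : ℕ → Tuple d α → List (Item d α) → Timed (List (Item d α))
  | _, _, [] => pure []
  | r, prev, x :: xs => do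
    tick 1
    let same ← sameTuple prev x.tup
    let r' := if same then r else r + 1
    let rest ← assignRanksFrom j r' x.tup xs
    pure (⟨x.tup, Function.update x.rank j r'⟩ :: rest)

def assignRanks (j : ℕ) : List (Item d α) → Timed (List (Item d α))
  | [] => pure []
  | x :: xs => assignRanksFrom j 0 x.tup (x :: xs)

/-- Sort by each of the listed attributes in turn and record the ranks; `k` bounds the depth of the
sorting recursion. The result is in the order of the last listed attribute. -/
def presort (k : ℕ) : List (Fin d) → List (Item d α) → Timed (List (Item d α))
  | [], xs => pure xs
  | j :: js, xs => do
    let ys ← mergeSortT (fun a b => keyLE j a.tup b.tup) k xs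
    let zs ← assignRanks j.val ys
    presort k js zs

/-- Split a list into the items whose rank in attribute `c` is below `mid` and the others. -/
def partitionRank (c mid : ℕ) : List (Item d α) → Timed (List (Item d α) × List (Item d α))
  | [] => pure ([], [])
  | x :: xs => do
    tick 1
    let p ← partitionRank c mid xs
    if x.rank c < mid then pure (x :: p.1, p.2) else pure (p.1, x :: p.2)

def rankLE (p : ℕ) (a b : Item d α) : Timed Bool := do
  tick 1
  pure (decide (a.rank p ≤ b.rank p))

/-- Is `b` beaten by the least rank in attribute `q` seen so far? -/
def beaten (q : ℕ) (best : Option ℕ) (b : Item d α) : Bool :=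
  match best with
  | none => false
  | some r => decide (r ≤ b.rank q)

def updateBest (q : ℕ) (best : Option ℕ) (a : Item d α) : Option ℕ :=
  match best with
  | none => some (a.rank q)
  | some r => some (min r (a.rank q))

/-- Two-attribute marriage step. `A` and `B` are in the order of attribute `p`; remove from `B` all
items that some item of `A` precedes in the attributes `p` and `q`. `best` is the least rank in
attribute `q` among the items of `A` that have been passed. -/
def sweep (p q : ℕ) : Option ℕ → List (Item d α) → List (Item d α) → Timed (List (Item d α))
  | _, _, [] => do tick 1; pure []
  | best, [], b :: B => do
    tick 2
    let B' ← sweep p q best [] B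
    if beaten q best b then pure B' else pure (b :: B')
  | best, a :: A, b :: B => do
    tick 2
    if a.rank p < b.rank p then
      sweep p q (updateBest q best a) A (b :: B)
    else
      let B' ← sweep p q best (a :: A) B
      if beaten q best b then pure B' else pure (b :: B')
termination_by _ A B => A.length + B.length

/-- One more attribute in the marriage step. All ranks of `A` and `B` in attribute `c` lie in
`[lo, lo + 2 ^ h)`; this range is halved. Items of the lower half of `A` precede those of the upper
half of `B` in attribute `c`, and `inner` deals with the attributes that are left. -/
def marrySplit (p c : ℕ)
    (inner : List (Item d α) → List (Item d α) → Timed (List (Item d α))) :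
    ℕ → ℕ → List (Item d α) → List (Item d α) → Timed (List (Item d α))
  | 0, _, _, B => do tick 1; pure B
  | h + 1, lo, A, B => do
    tick 1
    if A.isEmpty || B.isEmpty then pure B
    else
      let PA ← partitionRank c (lo + 2 ^ h) A
      let PB ← partitionRank c (lo + 2 ^ h) B
      let low ← marrySplit p c inner h lo PA.1 PB.1
      let cross ← inner PA.1 PB.2
      let high ← marrySplit p c inner h (lo + 2 ^ h) PA.2 cross
      mergeT (rankLE p) low high

/-- Marriage step: remove from `B` all items that some item of `A` dominates, where every item of `A`
precedes every item of `B` in attribute `0`. The attributes `1, …, d - 3` are split, and the attributes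
`d - 2` and `d - 1` are swept (for `d = 2` attribute `d - 2 = 0` imposes no condition). -/
def marry (H : ℕ) (A B : List (Item d α)) : Timed (List (Item d α)) :=
  (List.range' 1 (d - 3)).foldr (fun c inner => marrySplit (d - 1) c inner H 0)
    (sweep (d - 1) (d - 2) none) A B

/-- Divide and conquer: the ranks of `S` in attribute `0` lie in `[lo, lo + 2 ^ h)`. -/
def maxima (H : ℕ) : ℕ → ℕ → List (Item d α) → Timed (List (Item d α))
  | 0, _, S => do tick 1; pure S
  | h + 1, lo, S => do
    tick 1
    if S.isEmpty then pure []
    else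
      let P ← partitionRank 0 (lo + 2 ^ h) S
      let A ← maxima H h lo P.1
      let B ← maxima H h (lo + 2 ^ h) P.2
      let B' ← marry H A B
      mergeT (rankLE (d - 1)) A B'

/-- The skyline of a list of tuples, by presorting and divide and conquer. -/
def divideConquer (S : List (Tuple d α)) : Timed (List (Tuple d α)) := do
  let N ← lengthT S
  let H := Nat.clog 2 N
  tick (H + 1)
  let items ← mapT (fun t => (⟨t, fun _ => 0⟩ : Item d α)) S
  let sorted ← presort H (List.finRange d) items
  let sky ← maxima H H 0 sorted
  mapT Item.tup sky

/-- Does some tuple of the list `S` satisfy `s ⪯ t`? -/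
def covered (t : Tuple d α) : List (Tuple d α) → Timed Bool
  | [] => do tick 1; pure false
  | s :: S => do
    tick 1
    if (← weakDom s t) then pure true else covered t S

/-- Discard the tuples dominated by `x`. -/
def discard (x : Tuple d α) : List (Tuple d α) → Timed (List (Tuple d α))
  | [] => pure []
  | s :: S => do
    tick 1
    let r ← strictDom x s
    let S' ← discard x S
    if r then pure S' else pure (s :: S')

/-- FLET with virtual point `x`: if some tuple lies below `x` in all attributes, every tuple dominated
by `x` is discarded; the worst-case algorithm is run on what remains. -/
def fletWith (x : Tuple d α) (S : List (Tuple d α)) : Timed (List (Tuple d α)) := do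
  if (← covered x S) then
    let S' ← discard x S
    divideConquer S'
  else divideConquer S

end DivideConquer

/-! ### The algorithm DOUBLE -/

noncomputable section

/-- FLET with its virtual point: for `N` tuples all attributes of this point are `(ln N / N) ^ (1/d)`
(attribute values are normalized to `[0, 1]`; FLET is correct for all real values). -/
def getSkyline {d : ℕ} (S : List (Tuple d ℝ)) : Timed (List (Tuple d ℝ)) := do
  let N ← lengthT S
  tick (d + 4)
  fletWith (fun _ => (Real.log N / N) ^ ((1 : ℝ) / d)) S

/-- The skyline of the union of two skylines, by FLET. -/
def mergeSkyline {d : ℕ} (A B : List (Tuple d ℝ)) : Timed (List (Tuple d ℝ)) := do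
  let S ← appendT A B
  getSkyline S

/-- The input of DOUBLE: a relation with `n` tuples and `d` attributes, the error bound, the error
probability, and the initial sample size. -/
structure Input (d : ℕ) where
  n : ℕ
  T : Fin n → Tuple d ℝ
  ε : ℝ
  δ : ℝ
  sI : ℕ

/-- An outcome of all random draws: `S i` is the row drawn as the `i`-th element of the sample `S`,
and `V j i` is the row drawn as the `i`-th element of `V` in the `j`-th call of `verifyError`. -/
structure Draws (n : ℕ) where
  S : ℕ → Fin n
  V : ℕ → ℕ → Fin n

/-- Draw the sample elements number `a, …, a + len - 1`. -/
def draw {d n : ℕ} (T : Fin n → Tuple d ℝ) (row : ℕ → Fin n) :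
    ℕ → ℕ → Timed (List (Tuple d ℝ))
  | _, 0 => pure []
  | a, len + 1 => do
    tick 1
    let rest ← draw T row (a + 1) len
    pure (T (row a) :: rest)

/-- `ln log₂ n + ln (1 / δ)`. -/
def logTerm {d : ℕ} (I : Input d) : ℝ := Real.log (Real.logb 2 I.n) + Real.log (1 / I.δ)

/-- The size of each verification sample. -/
def verifySize {d : ℕ} (I : Input d) : ℕ := ⌈18 * logTerm I / I.ε⌉₊

/-- Number of tuples of the list that are not dominated by `sky`. -/
def countUncovered {d : ℕ} (sky : List (Tuple d ℝ)) : List (Tuple d ℝ) → Timed ℕ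
  | [] => pure 0
  | t :: V => do
    tick 1
    let r ← covered t sky
    let k ← countUncovered sky V
    if r then pure k else pure (k + 1)

def verifyError {d : ℕ} (I : Input d) (row : ℕ → Fin I.n) (sky : List (Tuple d ℝ)) :
    Timed ℝ := do
  tick 8
  let V ← draw I.T row 0 (verifySize I)
  let count ← countUncovered sky V
  tick 1
  pure ((count : ℝ) / (verifySize I : ℝ))

/-- The variables of DOUBLE just after a call of `verifyError`. -/
structure State (d : ℕ) where
  m : ℕ
  sky : List (Tuple d ℝ)
  err : ℝ

/-- The part of DOUBLE before the loop. -/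
def initRound {d : ℕ} (I : Input d) (ω : Draws I.n) : Timed (State d) := do
  tick 1
  let S ← draw I.T ω.S 0 I.sI
  let sky ← getSkyline S
  let err ← verifyError I (ω.V 0) sky
  pure ⟨I.sI, sky, err⟩

/-- The body of the loop, followed by the call of `verifyError` number `j`. The sample elements are
numbered from `0`, so the new ones are those with numbers `m, …, 2 * m - 1`. -/
def loopBody {d : ℕ} (I : Input d) (ω : Draws I.n) (j : ℕ) (s : State d) : Timed (State d) := do
  tick 1
  let S ← draw I.T ω.S s.m s.m
  let new ← getSkyline S
  let sky ← mergeSkyline s.sky new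
  let err ← verifyError I (ω.V j) sky
  pure ⟨2 * s.m, sky, err⟩

/-- Execution of DOUBLE up to and including the `j`-th passage through the body of the loop and the
test of the loop condition that follows it, with the number of steps up to that point. -/
def exec {d : ℕ} (I : Input d) (ω : Draws I.n) : ℕ → Timed (State d)
  | 0 => do
    let s ← initRound I ω
    tick 1
    pure s
  | j + 1 => do
    let s ← exec I ω j
    let s' ← loopBody I ω (j + 1) s
    tick 1
    pure s'

/-- On the draws `ω`, DOUBLE returns after exactly `k` passages through the body of the loop, that is,
after `k + 1` calls of `verifyError`. -/
def ReturnsAfter {d : ℕ} (I : Input d) (ω : Draws I.n) (k : ℕ) : Prop :=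
  (exec I ω k).val.err ≤ 2 * I.ε / 3 ∧ ∀ j < k, 2 * I.ε / 3 < (exec I ω j).val.err

/-- The value of `m` after `k` passages through the body of the loop. -/
def sampleSize {d : ℕ} (I : Input d) (ω : Draws I.n) (k : ℕ) : ℕ := (exec I ω k).val.m

/-- The approximate skyline after `k` passages through the body of the loop. -/
def approxSky {d : ℕ} (I : Input d) (ω : Draws I.n) (k : ℕ) : List (Tuple d ℝ) :=
  (exec I ω k).val.sky

/-- The running time of an execution that returns after `k` passages through the body of the loop. -/
def runTime {d : ℕ} (I : Input d) (ω : Draws I.n) (k : ℕ) : ℕ := (exec I ω k).cost + 1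

/-- The parameters make sense: `n ≥ 2` (so that `ln log₂ n ≥ 0`), `ε > 0`, `0 < δ < 1`, and the initial
sample size is a positive integer. -/
def Input.Valid {d : ℕ} (I : Input d) : Prop :=
  2 ≤ I.n ∧ 0 < I.ε ∧ 0 < I.δ ∧ I.δ < 1 ∧ 1 ≤ I.sI

end

end Skyline

/-!
The cost of the divide-and-conquer algorithm is controlled by the depth parameter `H = ⌈log₂ N⌉`
alone: a call on an empty list takes one step, every other call splits its lists into disjoint
parts, and no list ever becomes longer, so each of the `H` levels of a recursion takes linear time
plus the time of the inner calls. Hence the marriage step costs `O (N (H + 1) ^ (d - 3))`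
(`cost_marry_le`; the exponent is `0` for `d = 2`), the whole recursion gains one more factor `H`
(`cost_maxima_le`), presorting costs `O (N H)`, and FLET inherits the bound `O ((N + 1) (H + 1) ^
(d - 1))` (`exists_cost_getSkyline_le`). No property of the ranks is needed for this.

In DOUBLE the sample sizes form a geometric progression ending in `m_q`, and the list given to
`mergeSkyline` has at most twice as many tuples as the preceding sample. So all skyline
computations together cost `O (m_q log ^ (d - 1) m_q)` (`exists_cost_exec_le`).

A verification scans the skyline once for each of the `s_v` sampled tuples, which sums up to `O
(s_v * ∑ |sky|)`, where `s_v ≤ 18 (ln log₂ n + ln (1 / δ)) / ε + 1`. The sum over all rounds is at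
most `2 m_q`, because a skyline is no larger than its sample; this gives the bound for fixed `ε`
and pays for the rounding of `s_v`. If every skyline has at most `K ε m_q` tuples, the sum over
the at most `log₂ m_q + 1` rounds is at most `K ε m_q (log₂ m_q + 1)`, and `ε` cancels.

The bound in terms of `K` also uses that verified skylines are not empty (`length_approxSky_pos`):
this forces `K > 0` and lets the scans pay for drawing the verification sample. It holds because
the marriage step with an empty list removes nothing (`marry_nil_left`), and because a tuple that
allows FLET to discard others is not discarded itself.
-/

namespace Skyline

/-! ### Reading off results and costs -/

section Basic

variable {β γ : Type}

@[simp] lemma val_pure (a : β) : (pure a : Timed β).val = a := rfl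

@[simp] lemma cost_pure (a : β) : (pure a : Timed β).cost = 0 := rfl

@[simp] lemma val_bind (x : Timed β) (f : β → Timed γ) : (x >>= f).val = (f x.val).val := rfl

@[simp] lemma cost_bind (x : Timed β) (f : β → Timed γ) :
    (x >>= f).cost = x.cost + (f x.val).cost := rfl

@[simp] lemma cost_tick (k : ℕ) : (tick k).cost = k := rfl

end Basic

/-! ### Comparisons of tuples -/

section Comparisons

variable {d : ℕ} {α : Type} [LinearOrder α]

lemma cost_leOn_le (a b : Tuple d α) (is : List (Fin d)) : (leOn a b is).cost ≤ is.length := by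
  induction is with
  | nil => simp [leOn]
  | cons i is ih =>
    simp only [leOn, cost_bind, cost_tick, List.length_cons]
    split_ifs
    · omega
    · simp

lemma cost_weakDom_le (a b : Tuple d α) : (weakDom a b).cost ≤ d := by
  simpa [weakDom] using cost_leOn_le a b (List.finRange d)

lemma cost_sameTuple_le (a b : Tuple d α) : (sameTuple a b).cost ≤ 2 * d := by
  have h₁ := cost_weakDom_le a b
  have h₂ := cost_weakDom_le b a
  simp only [sameTuple, cost_bind]
  split_ifs <;> simp <;> omega

lemma cost_strictDom_le (a b : Tuple d α) : (strictDom a b).cost ≤ 2 * d := by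
  have h₁ := cost_weakDom_le a b
  have h₂ := cost_weakDom_le b a
  simp only [strictDom, cost_bind]
  split_ifs <;> simp <;> omega

lemma strictDom_eq_false_of_weakDom {a b : Tuple d α} (h : (weakDom b a).val = true) :
    (strictDom a b).val = false := by
  simp only [strictDom, val_bind]
  split_ifs <;> simp [h]

lemma cost_lexLE_le (a b : Tuple d α) (is : List (Fin d)) :
    (lexLE a b is).cost ≤ 2 * is.length := by
  induction is with
  | nil => simp [lexLE]
  | cons i is ih =>
    simp only [lexLE, cost_bind, cost_tick, List.length_cons]
    split_ifs
    · simp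
    · simp
    · omega

lemma cost_keyLE_le (j : Fin d) (a b : Tuple d α) : (keyLE j a b).cost ≤ 2 * (d + 1) := by
  simpa [keyLE] using cost_lexLE_le a b (j :: List.finRange d)

end Comparisons

/-! ### List operations and merge sort -/

section Lists

variable {β γ : Type}

@[simp] lemma cost_lengthT (xs : List β) : (lengthT xs).cost = xs.length := by
  induction xs with
  | nil => rfl
  | cons x xs ih => simp [lengthT, ih, add_comm]

@[simp] lemma val_lengthT (xs : List β) : (lengthT xs).val = xs.length := by
  induction xs with
  | nil => rfl
  | cons x xs ih => simp [lengthT, ih]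

@[simp] lemma cost_mapT (f : β → γ) (xs : List β) : (mapT f xs).cost = xs.length := by
  induction xs with
  | nil => rfl
  | cons x xs ih => simp [mapT, ih, add_comm]

@[simp] lemma val_mapT (f : β → γ) (xs : List β) : (mapT f xs).val = xs.map f := by
  induction xs with
  | nil => rfl
  | cons x xs ih => simp [mapT, ih]

@[simp] lemma cost_appendT (xs ys : List β) : (appendT xs ys).cost = xs.length := by
  induction xs with
  | nil => rfl
  | cons x xs ih => simp [appendT, ih, add_comm]

@[simp] lemma val_appendT (xs ys : List β) : (appendT xs ys).val = xs ++ ys := by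
  induction xs with
  | nil => rfl
  | cons x xs ih => simp [appendT, ih]

@[simp] lemma length_mergeT (le : β → β → Timed Bool) (xs ys : List β) :
    (mergeT le xs ys).val.length = xs.length + ys.length := by
  induction xs generalizing ys with
  | nil => simp [mergeT]
  | cons x xs ihx =>
    induction ys with
    | nil => simp [mergeT]
    | cons y ys ihy =>
      rw [mergeT]
      simp only [val_bind]
      split_ifs
      · simp [ihx]; omega
      · simp [ihy]; omega

lemma cost_mergeT_le {le : β → β → Timed Bool} {w : ℕ} (hle : ∀ a b, (le a b).cost ≤ w)
    (xs ys : List β) : (mergeT le xs ys).cost ≤ (w + 1) * (xs.length + ys.length) + 1 := by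
  induction xs generalizing ys with
  | nil => simp [mergeT]
  | cons x xs ihx =>
    induction ys with
    | nil => simp [mergeT]
    | cons y ys ihy =>
      have h := hle x y
      have hx := ihx (y :: ys)
      rw [mergeT]
      simp only [cost_bind, cost_tick, List.length_cons] at hx ihy ⊢
      split_ifs
      · simp only [cost_bind, cost_pure]; linarith
      · simp only [cost_bind, cost_pure]; linarith

@[simp] lemma cost_deal (xs : List β) : (deal xs).cost = xs.length := by
  induction xs with
  | nil => rfl
  | cons x xs ih => simp [deal, ih, add_comm]

lemma length_deal (xs : List β) :
    (deal xs).val.1.length + (deal xs).val.2.length = xs.length := by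
  induction xs with
  | nil => rfl
  | cons x xs ih => simp [deal, ← ih]; omega

@[simp] lemma length_mergeSortT (le : β → β → Timed Bool) (k : ℕ) (xs : List β) :
    (mergeSortT le k xs).val.length = xs.length := by
  induction k generalizing xs with
  | zero =>
    match xs with
    | [] => simp [mergeSortT]
    | [x] => simp [mergeSortT]
    | x :: y :: xs => simp [mergeSortT]
  | succ k ih =>
    match xs with
    | [] => simp [mergeSortT]
    | [x] => simp [mergeSortT]
    | x :: y :: xs => simp [mergeSortT, ih, length_deal (x :: y :: xs)]

/-- The depth parameter `k` bounds the number of levels of the recursion, and the merges of one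
level take time linear in the length of the list. -/
lemma cost_mergeSortT_le {le : β → β → Timed Bool} {w : ℕ} (hle : ∀ a b, (le a b).cost ≤ w)
    (k : ℕ) (xs : List β) : (mergeSortT le k xs).cost ≤ 1 + (w + 5) * k * xs.length := by
  induction k generalizing xs with
  | zero =>
    match xs with
    | [] => simp [mergeSortT]
    | [x] => simp [mergeSortT]
    | x :: y :: xs => simp [mergeSortT]
  | succ k ih =>
    match xs with
    | [] => simp [mergeSortT]
    | [x] => simp [mergeSortT]
    | x :: y :: xs =>
      rw [mergeSortT]
      · have hd := length_deal (x :: y :: xs)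
        have hpos : 1 ≤ (x :: y :: xs).length := by simp
        simp only [cost_bind, cost_tick, cost_deal]
        generalize x :: y :: xs = zs at *
        have ha := ih (deal zs).val.1
        have hb := ih (deal zs).val.2
        have hm := cost_mergeT_le hle (mergeSortT le k (deal zs).val.1).val
          (mergeSortT le k (deal zs).val.2).val
        rw [length_mergeSortT, length_mergeSortT, hd] at hm
        rw [← hd] at hpos hm ⊢
        nlinarith
      · simp
      · simp

end Lists

/-! ### Presorting -/

section Presort

variable {d : ℕ} {α : Type} [LinearOrder α]

lemma length_assignRanksFrom (j r : ℕ) (prev : Tuple d α) (xs : List (Item d α)) :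
    (assignRanksFrom j r prev xs).val.length = xs.length := by
  induction xs generalizing r prev with
  | nil => rfl
  | cons x xs ih => simp [assignRanksFrom, ih]

@[simp] lemma length_assignRanks (j : ℕ) (xs : List (Item d α)) :
    (assignRanks j xs).val.length = xs.length := by
  cases xs with
  | nil => rfl
  | cons x xs => exact length_assignRanksFrom j 0 x.tup (x :: xs)

lemma cost_assignRanksFrom_le (j r : ℕ) (prev : Tuple d α) (xs : List (Item d α)) :
    (assignRanksFrom j r prev xs).cost ≤ (2 * d + 1) * xs.length := by
  induction xs generalizing r prev with
  | nil => simp [assignRanksFrom]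
  | cons x xs ih =>
    have h := cost_sameTuple_le prev x.tup
    simp only [assignRanksFrom, cost_bind, cost_tick, cost_pure, List.length_cons]
    have := ih (if (sameTuple prev x.tup).val = true then r else r + 1) x.tup
    linarith

lemma cost_assignRanks_le (j : ℕ) (xs : List (Item d α)) :
    (assignRanks j xs).cost ≤ (2 * d + 1) * xs.length := by
  cases xs with
  | nil => simp [assignRanks]
  | cons x xs => exact cost_assignRanksFrom_le j 0 x.tup (x :: xs)

@[simp] lemma length_presort (k : ℕ) (js : List (Fin d)) (xs : List (Item d α)) :
    (presort k js xs).val.length = xs.length := by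
  induction js generalizing xs with
  | nil => rfl
  | cons j js ih => simp [presort, ih]

lemma cost_presort_le (k : ℕ) (js : List (Fin d)) (xs : List (Item d α)) :
    (presort k js xs).cost ≤
      js.length * (1 + (2 * d + 7) * k * xs.length + (2 * d + 1) * xs.length) := by
  induction js generalizing xs with
  | nil => simp [presort]
  | cons j js ih =>
    have h₁ := cost_mergeSortT_le (fun a b : Item d α => cost_keyLE_le j a.tup b.tup) k xs
    have h₂ := cost_assignRanks_le j.val
      (mergeSortT (fun a b : Item d α => keyLE j a.tup b.tup) k xs).val
    have h₃ := ih (assignRanks j.val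
      (mergeSortT (fun a b : Item d α => keyLE j a.tup b.tup) k xs).val).val
    simp only [length_mergeSortT, length_assignRanks] at h₂ h₃
    simp only [presort, cost_bind, List.length_cons]
    linarith

end Presort

/-! ### The marriage step -/

section DivideConquer

variable {d : ℕ} {α : Type}

@[simp] lemma cost_partitionRank (c mid : ℕ) (xs : List (Item d α)) :
    (partitionRank c mid xs).cost = xs.length := by
  induction xs with
  | nil => rfl
  | cons x xs ih =>
    simp only [partitionRank, cost_bind, cost_tick, ih, List.length_cons]
    split_ifs <;> simp <;> omega

lemma length_partitionRank (c mid : ℕ) (xs : List (Item d α)) :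
    (partitionRank c mid xs).val.1.length + (partitionRank c mid xs).val.2.length
      = xs.length := by
  induction xs with
  | nil => rfl
  | cons x xs ih =>
    simp only [partitionRank, val_bind, List.length_cons]
    split_ifs <;> simp <;> omega

lemma cost_mergeT_rankLE_le (p : ℕ) (xs ys : List (Item d α)) :
    (mergeT (rankLE p) xs ys).cost ≤ 2 * (xs.length + ys.length) + 1 :=
  cost_mergeT_le (w := 1) (fun a b => by simp [rankLE]) xs ys

lemma length_sweep_le (p q : ℕ) (best : Option ℕ) (A B : List (Item d α)) :
    (sweep p q best A B).val.length ≤ B.length := by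
  induction A generalizing best B with
  | nil =>
    induction B with
    | nil => simp [sweep]
    | cons b B ihB =>
      rw [sweep]
      simp only [val_bind]
      split_ifs <;> simp <;> omega
  | cons a A ihA =>
    induction B with
    | nil => simp [sweep]
    | cons b B ihB =>
      rw [sweep]
      simp only [val_bind]
      split_ifs
      · exact ihA _ _
      · simp only [val_bind, val_pure, List.length_cons]; omega
      · simp only [val_bind, val_pure, List.length_cons]; omega

lemma cost_sweep_le (p q : ℕ) (best : Option ℕ) (A B : List (Item d α)) :
    (sweep p q best A B).cost ≤ 1 + 2 * (A.length + B.length) := by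
  induction A generalizing best B with
  | nil =>
    induction B with
    | nil => simp [sweep]
    | cons b B ihB =>
      rw [sweep]
      simp only [cost_bind, cost_tick, List.length_cons, List.length_nil] at ihB ⊢
      split_ifs <;> simp only [cost_pure] <;> omega
  | cons a A ihA =>
    induction B with
    | nil => simp [sweep]
    | cons b B ihB =>
      have h := ihA (updateBest q best a) (b :: B)
      rw [sweep]
      simp only [cost_bind, cost_tick, List.length_cons] at h ihB ⊢
      split_ifs
      · omega
      · simp only [cost_bind, cost_pure]; omega
      · simp only [cost_bind, cost_pure]; omega

lemma sweep_nil_left (p q : ℕ) (B : List (Item d α)) : (sweep p q none [] B).val = B := by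
  induction B with
  | nil => simp [sweep]
  | cons b B ih => simp [sweep, beaten, ih]

section MarrySplit

variable {p c : ℕ} {inner : List (Item d α) → List (Item d α) → Timed (List (Item d α))}

lemma length_marrySplit_le (hlen : ∀ A B, (inner A B).val.length ≤ B.length) (h lo : ℕ)
    (A B : List (Item d α)) : (marrySplit p c inner h lo A B).val.length ≤ B.length := by
  induction h generalizing lo A B with
  | zero => simp [marrySplit]
  | succ h ih =>
    simp only [marrySplit, val_bind]
    split_ifs
    · simp
    · simp only [val_bind, length_mergeT]
      rw [← length_partitionRank c (lo + 2 ^ h) B]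
      exact add_le_add (ih _ _ _) ((ih _ _ _).trans (hlen _ _))

/-- A further attribute multiplies the cost of the marriage step by the number `h` of levels: the
halves of `A` and of `B` are disjoint and `inner` is called once on each level of a branch. Calls
with an empty list cost one step, so that every call that recurses has an item to charge to. -/
lemma cost_marrySplit_le {K : ℕ} (hlen : ∀ A B, (inner A B).val.length ≤ B.length)
    (hcost : ∀ A B, (inner A B).cost ≤ 1 + K * (A.length + B.length)) (h lo : ℕ)
    (A B : List (Item d α)) :
    (marrySplit p c inner h lo A B).cost ≤ 1 + (K + 8) * h * (A.length + B.length) := by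
  induction h generalizing lo A B with
  | zero => simp [marrySplit]
  | succ h ih =>
    simp only [marrySplit, cost_bind, cost_tick]
    split_ifs with he
    · simp
    · have hpos : 1 ≤ A.length := by
        rw [Nat.one_le_iff_ne_zero]
        simp at he ⊢
        exact he.1
      simp only [cost_bind, cost_partitionRank]
      have hA := length_partitionRank c (lo + 2 ^ h) A
      have hB := length_partitionRank c (lo + 2 ^ h) B
      generalize (partitionRank c (lo + 2 ^ h) A).val = PA at *
      generalize (partitionRank c (lo + 2 ^ h) B).val = PB at *
      have hlow := length_marrySplit_le (p := p) (c := c) hlen h lo PA.1 PB.1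
      have hcross := hlen PA.1 PB.2
      have hhigh := length_marrySplit_le (p := p) (c := c) hlen h (lo + 2 ^ h) PA.2
        (inner PA.1 PB.2).val
      have clow := ih lo PA.1 PB.1
      have ccross := hcost PA.1 PB.2
      have chigh := ih (lo + 2 ^ h) PA.2 (inner PA.1 PB.2).val
      have cmerge := cost_mergeT_rankLE_le p (marrySplit p c inner h lo PA.1 PB.1).val
        (marrySplit p c inner h (lo + 2 ^ h) PA.2 (inner PA.1 PB.2).val).val
      have chigh' : (K + 8) * h * (PA.2.length + (inner PA.1 PB.2).val.length) ≤
          (K + 8) * h * (PA.2.length + PB.2.length) := by gcongr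
      have ccross' : K * (PA.1.length + PB.2.length) ≤ K * (A.length + B.length) := by
        gcongr <;> omega
      have hsplit : (K + 8) * h * (PA.1.length + PB.1.length) +
          (K + 8) * h * (PA.2.length + PB.2.length) = (K + 8) * h * (A.length + B.length) := by
        rw [← hA, ← hB]; ring
      linarith

end MarrySplit

lemma length_marry_le (H : ℕ) (A B : List (Item d α)) : (marry H A B).val.length ≤ B.length := by
  unfold marry
  generalize List.range' 1 (d - 3) = cs
  induction cs generalizing A B with
  | nil => exact length_sweep_le _ _ _ A B
  | cons c cs ih => exact length_marrySplit_le ih H 0 A B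

/-- Nothing is removed from `B` when there is nothing to beat it. -/
lemma marry_nil_left (H : ℕ) (B : List (Item d α)) : (marry H [] B).val = B := by
  unfold marry
  cases List.range' 1 (d - 3) with
  | nil => exact sweep_nil_left _ _ B
  | cons c cs => cases H <;> simp [marrySplit]

lemma cost_marry_le (H : ℕ) (A B : List (Item d α)) :
    (marry H A B).cost ≤
      1 + 10 ^ (d - 3 + 1) * (H + 1) ^ (d - 3) * (A.length + B.length) := by
  have key : ∀ (cs : List ℕ) (A B : List (Item d α)),
      (cs.foldr (fun c inner => marrySplit (d - 1) c inner H 0)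
        (sweep (d - 1) (d - 2) none) A B).val.length ≤ B.length ∧
      (cs.foldr (fun c inner => marrySplit (d - 1) c inner H 0)
        (sweep (d - 1) (d - 2) none) A B).cost ≤
        1 + 10 ^ (cs.length + 1) * (H + 1) ^ cs.length * (A.length + B.length) := by
    intro cs
    induction cs with
    | nil =>
      intro A B
      refine ⟨length_sweep_le _ _ _ A B, (cost_sweep_le _ _ _ A B).trans ?_⟩
      simp only [List.length_nil, pow_zero]
      omega
    | cons c cs ih =>
      intro A B
      refine ⟨length_marrySplit_le (fun A B => (ih A B).1) H 0 A B,
        (cost_marrySplit_le (fun A B => (ih A B).1) (fun A B => (ih A B).2) H 0 A B).trans ?_⟩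
      have h1 : 1 ≤ 10 ^ (cs.length + 1) * (H + 1) ^ cs.length :=
        Nat.one_le_iff_ne_zero.2 (by positivity)
      rw [List.length_cons, pow_succ 10 (cs.length + 1), pow_succ (H + 1) cs.length]
      refine Nat.add_le_add_left (Nat.mul_le_mul_right _ ?_) 1
      calc (10 ^ (cs.length + 1) * (H + 1) ^ cs.length + 8) * H
          ≤ (10 ^ (cs.length + 1) * (H + 1) ^ cs.length * 10) * (H + 1) := by
            gcongr <;> omega
        _ = _ := by ring
  simpa [marry] using (key (List.range' 1 (d - 3)) A B).2

/-! ### Divide and conquer -/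

lemma length_maxima_le (H h lo : ℕ) (S : List (Item d α)) :
    (maxima H h lo S).val.length ≤ S.length := by
  induction h generalizing lo S with
  | zero => simp [maxima]
  | succ h ih =>
    simp only [maxima, val_bind]
    split_ifs
    · simp
    · simp only [val_bind, length_mergeT]
      rw [← length_partitionRank 0 (lo + 2 ^ h) S]
      exact add_le_add (ih _ _) ((length_marry_le _ _ _).trans (ih _ _))

lemma maxima_nil (H h lo : ℕ) : (maxima H h lo ([] : List (Item d α))).val = [] :=
  List.eq_nil_of_length_eq_zero (Nat.le_zero.1 (length_maxima_le H h lo []))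

/-- If the lower half is not empty, its maxima survive; otherwise nothing is removed from the
maxima of the upper half. -/
lemma length_maxima_pos (H h lo : ℕ) {S : List (Item d α)} (hS : 0 < S.length) :
    0 < (maxima H h lo S).val.length := by
  induction h generalizing lo S with
  | zero => simpa [maxima] using hS
  | succ h ih =>
    have hP := length_partitionRank 0 (lo + 2 ^ h) S
    simp only [maxima, val_bind]
    split_ifs with he
    · simp_all
    · simp only [val_bind, length_mergeT]
      rcases Nat.eq_zero_or_pos (partitionRank 0 (lo + 2 ^ h) S).val.1.length with h0 | h0
      · rw [List.eq_nil_of_length_eq_zero h0, maxima_nil, marry_nil_left]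
        have := ih (lo + 2 ^ h) (S := (partitionRank 0 (lo + 2 ^ h) S).val.2) (by omega)
        omega
      · have := ih lo h0
        omega

lemma cost_maxima_le {K H : ℕ}
    (hK : ∀ A B : List (Item d α), (marry H A B).cost ≤ 1 + K * (A.length + B.length))
    (h lo : ℕ) (S : List (Item d α)) :
    (maxima H h lo S).cost ≤ 1 + (K + 8) * h * S.length := by
  induction h generalizing lo S with
  | zero => simp [maxima]
  | succ h ih =>
    simp only [maxima, cost_bind, cost_tick]
    split_ifs with he
    · simp
    · have hpos : 1 ≤ S.length := by
        rw [Nat.one_le_iff_ne_zero]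
        simpa using he
      simp only [cost_bind, cost_partitionRank]
      have hP := length_partitionRank 0 (lo + 2 ^ h) S
      generalize (partitionRank 0 (lo + 2 ^ h) S).val = P at *
      have hA := length_maxima_le H h lo P.1
      have hB := length_maxima_le H h (lo + 2 ^ h) P.2
      have cA := ih lo P.1
      have cB := ih (lo + 2 ^ h) P.2
      generalize maxima H h lo P.1 = A at *
      generalize maxima H h (lo + 2 ^ h) P.2 = B at *
      have hB' := length_marry_le H A.val B.val
      have cB' := hK A.val B.val
      have cmerge := cost_mergeT_rankLE_le (d - 1) A.val (marry H A.val B.val).val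
      have cB'' : K * (A.val.length + B.val.length) ≤ K * S.length := by gcongr; omega
      have hsplit : (K + 8) * h * P.1.length + (K + 8) * h * P.2.length =
          (K + 8) * h * S.length := by rw [← hP]; ring
      linarith

end DivideConquer

section Flet

variable {d : ℕ} {α : Type} [LinearOrder α]

lemma length_divideConquer_le (S : List (Tuple d α)) :
    (divideConquer S).val.length ≤ S.length := by
  simpa [divideConquer] using length_maxima_le _ _ 0 (presort (Nat.clog 2 S.length)
    (List.finRange d) (S.map fun t => (⟨t, fun _ => 0⟩ : Item d α))).val

lemma length_divideConquer_pos {S : List (Tuple d α)} (hS : 0 < S.length) :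
    0 < (divideConquer S).val.length := by
  simp only [divideConquer, val_bind, val_lengthT, val_mapT, List.length_map]
  exact length_maxima_pos _ _ _ (by simpa using hS)

lemma exists_cost_divideConquer_le (d : ℕ) (hd : 2 ≤ d) (α : Type) [LinearOrder α] :
    ∃ c : ℕ, ∀ S : List (Tuple d α),
      (divideConquer S).cost ≤ c * ((S.length + 1) * (Nat.clog 2 S.length + 1) ^ (d - 1)) := by
  refine ⟨5 + d * (4 * d + 9) + (10 ^ (d - 3 + 1) + 8), fun S => ?_⟩
  have hpre := cost_presort_le (Nat.clog 2 S.length) (List.finRange d)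
    (S.map fun t => (⟨t, fun _ => 0⟩ : Item d α))
  have hmax := cost_maxima_le (cost_marry_le (d := d) (α := α) (Nat.clog 2 S.length))
    (Nat.clog 2 S.length) 0 (presort (Nat.clog 2 S.length) (List.finRange d)
      (S.map fun t => (⟨t, fun _ => 0⟩ : Item d α))).val
  have hlen := length_maxima_le (Nat.clog 2 S.length) (Nat.clog 2 S.length) 0
    (presort (Nat.clog 2 S.length) (List.finRange d)
      (S.map fun t => (⟨t, fun _ => 0⟩ : Item d α))).val
  simp only [length_presort, List.length_map, List.length_finRange] at hpre hmax hlen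
  simp only [divideConquer, cost_bind, cost_lengthT, val_lengthT, cost_tick, cost_mapT, val_mapT]
  generalize Nat.clog 2 S.length = H at *
  generalize S.length = N at *
  set Q := (N + 1) * (H + 1) ^ (d - 1) with hQ
  have hG : H + 1 ≤ (H + 1) ^ (d - 1) := Nat.le_self_pow (by omega) _
  have hNH : (N + 1) * (H + 1) ≤ Q := Nat.mul_le_mul_left _ hG
  have e1 : N ≤ Q := by nlinarith
  have e2 : H + 1 ≤ Q := by nlinarith
  have e3 : H * N ≤ Q := by nlinarith
  -- For `d = 2` there is no split attribute, and the exponents are `0` and `1`.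
  have e4 : (H + 1) ^ (d - 3) * H * N ≤ Q := by
    calc (H + 1) ^ (d - 3) * H * N ≤ (H + 1) ^ (d - 3) * (H + 1) * (N + 1) := by
          gcongr <;> omega
      _ = (N + 1) * (H + 1) ^ (d - 3 + 1) := by ring
      _ ≤ Q := by
          rw [hQ]
          gcongr <;> omega
  have hpre' : d * (1 + (2 * d + 7) * H * N + (2 * d + 1) * N) ≤ d * (4 * d + 9) * Q := by
    rw [mul_assoc d]
    gcongr
    nlinarith
  have e5 : 10 ^ (d - 3 + 1) * ((H + 1) ^ (d - 3) * H * N) ≤ 10 ^ (d - 3 + 1) * Q := by gcongr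
  linarith

/-! ### FLET -/

lemma cost_covered_le (t : Tuple d α) (S : List (Tuple d α)) :
    (covered t S).cost ≤ 1 + (d + 1) * S.length := by
  induction S with
  | nil => simp [covered]
  | cons s S ih =>
    have h := cost_weakDom_le s t
    simp only [covered, cost_bind, cost_tick, List.length_cons]
    split_ifs
    · simp only [cost_pure]; linarith
    · linarith

lemma exists_weakDom_of_covered {t : Tuple d α} {S : List (Tuple d α)}
    (h : (covered t S).val = true) : ∃ s ∈ S, (weakDom s t).val = true := by
  induction S with
  | nil => simp [covered] at h
  | cons s S ih =>
    simp only [covered, val_bind] at h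
    split_ifs at h with hs
    · exact ⟨s, by simp, hs⟩
    · obtain ⟨u, hu, hut⟩ := ih h
      exact ⟨u, by simp [hu], hut⟩

lemma cost_discard_le (x : Tuple d α) (S : List (Tuple d α)) :
    (discard x S).cost ≤ (2 * d + 1) * S.length := by
  induction S with
  | nil => simp [discard]
  | cons s S ih =>
    have h := cost_strictDom_le x s
    simp only [discard, cost_bind, cost_tick, List.length_cons]
    split_ifs <;> simp only [cost_pure] <;> linarith

lemma length_discard_le (x : Tuple d α) (S : List (Tuple d α)) :
    (discard x S).val.length ≤ S.length := by
  induction S with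
  | nil => simp [discard]
  | cons s S ih =>
    simp only [discard, val_bind, List.length_cons]
    split_ifs <;> simp <;> omega

lemma mem_discard {x s : Tuple d α} {S : List (Tuple d α)} (hs : s ∈ S)
    (h : (strictDom x s).val = false) : s ∈ (discard x S).val := by
  induction S with
  | nil => simp at hs
  | cons u S ih =>
    simp only [discard, val_bind]
    rcases List.mem_cons.1 hs with rfl | hs
    · simp [h]
    · split_ifs <;> simp [ih hs]

lemma length_fletWith_le (x : Tuple d α) (S : List (Tuple d α)) :
    (fletWith x S).val.length ≤ S.length := by
  simp only [fletWith, val_bind]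
  split_ifs
  · exact (length_divideConquer_le _).trans (length_discard_le x S)
  · exact length_divideConquer_le S

/-- A tuple `s ⪯ x` that triggers the elimination is not itself eliminated. -/
lemma length_fletWith_pos (x : Tuple d α) {S : List (Tuple d α)} (hS : 0 < S.length) :
    0 < (fletWith x S).val.length := by
  simp only [fletWith, val_bind]
  split_ifs with h
  · obtain ⟨s, hs, hsx⟩ := exists_weakDom_of_covered h
    exact length_divideConquer_pos
      (List.length_pos_of_mem (mem_discard hs (strictDom_eq_false_of_weakDom hsx)))
  · exact length_divideConquer_pos hS

lemma exists_cost_fletWith_le (d : ℕ) (hd : 2 ≤ d) (α : Type) [LinearOrder α] :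
    ∃ c : ℕ, ∀ (x : Tuple d α) (S : List (Tuple d α)),
      (fletWith x S).cost ≤ c * ((S.length + 1) * (Nat.clog 2 S.length + 1) ^ (d - 1)) := by
  obtain ⟨c, hc⟩ := exists_cost_divideConquer_le d hd α
  refine ⟨c + (3 * d + 2), fun x S => ?_⟩
  have h₁ := cost_covered_le x S
  have h₂ := cost_discard_le x S
  have hlin : S.length + 1 ≤ (S.length + 1) * (Nat.clog 2 S.length + 1) ^ (d - 1) :=
    Nat.le_mul_of_pos_right _ (by positivity)
  have hlin' := Nat.mul_le_mul_left (3 * d + 2) hlin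
  have hdc : ∀ S' : List (Tuple d α), S'.length ≤ S.length → (divideConquer S').cost ≤
      c * ((S.length + 1) * (Nat.clog 2 S.length + 1) ^ (d - 1)) := fun S' h =>
    (hc S').trans (by gcongr)
  simp only [fletWith, cost_bind]
  split_ifs
  · have h₃ := hdc _ (length_discard_le x S)
    simp only [cost_bind]
    linarith
  · have h₃ := hdc S le_rfl
    linarith

end Flet

/-! ### Skylines of real tuples -/

section Sky

variable {d : ℕ}

lemma length_getSkyline_le (S : List (Tuple d ℝ)) : (getSkyline S).val.length ≤ S.length :=
  length_fletWith_le _ S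

lemma length_getSkyline_pos {S : List (Tuple d ℝ)} (hS : 0 < S.length) :
    0 < (getSkyline S).val.length :=
  length_fletWith_pos _ hS

lemma exists_cost_getSkyline_le (d : ℕ) (hd : 2 ≤ d) :
    ∃ c : ℕ, ∀ (S : List (Tuple d ℝ)) (M : ℕ), S.length ≤ M →
      (getSkyline S).cost ≤ c * ((S.length + 1) * (Nat.clog 2 M + 1) ^ (d - 1)) := by
  obtain ⟨c, hc⟩ := exists_cost_fletWith_le d hd ℝ
  refine ⟨c + (d + 4), fun S M hM => ?_⟩
  simp only [getSkyline, cost_bind, cost_lengthT, val_lengthT, cost_tick]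
  have h₁ := hc (fun _ => (Real.log S.length / S.length) ^ ((1 : ℝ) / d)) S
  have h₂ : (S.length + 1) * (Nat.clog 2 S.length + 1) ^ (d - 1) ≤
      (S.length + 1) * (Nat.clog 2 M + 1) ^ (d - 1) := by gcongr
  have h₃ : S.length + 1 ≤ (S.length + 1) * (Nat.clog 2 M + 1) ^ (d - 1) :=
    Nat.le_mul_of_pos_right _ (by positivity)
  have h₄ := h₁.trans (Nat.mul_le_mul_left c h₂)
  have h₅ := Nat.mul_le_mul_left (d + 4) h₃
  have h₆ : S.length + (d + 4) ≤ (d + 4) * (S.length + 1) := by nlinarith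
  linarith

lemma length_mergeSkyline_le (A B : List (Tuple d ℝ)) :
    (mergeSkyline A B).val.length ≤ A.length + B.length := by
  simpa [mergeSkyline] using length_getSkyline_le (A ++ B)

lemma length_mergeSkyline_pos {A B : List (Tuple d ℝ)} (hA : 0 < A.length) :
    0 < (mergeSkyline A B).val.length := by
  simpa [mergeSkyline] using length_getSkyline_pos (S := A ++ B) (by simp; omega)

/-! ### One round of DOUBLE -/

@[simp] lemma length_draw {n : ℕ} (T : Fin n → Tuple d ℝ) (row : ℕ → Fin n) (a len : ℕ) :
    (draw T row a len).val.length = len := by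
  induction len generalizing a with
  | zero => rfl
  | succ len ih => simp [draw, ih]

@[simp] lemma cost_draw {n : ℕ} (T : Fin n → Tuple d ℝ) (row : ℕ → Fin n) (a len : ℕ) :
    (draw T row a len).cost = len := by
  induction len generalizing a with
  | zero => rfl
  | succ len ih => simp [draw, ih, add_comm]

lemma cost_countUncovered_le (sky V : List (Tuple d ℝ)) :
    (countUncovered sky V).cost ≤ V.length * (2 + (d + 1) * sky.length) := by
  induction V with
  | nil => simp [countUncovered]
  | cons t V ih =>
    have h := cost_covered_le t sky
    simp only [countUncovered, cost_bind, cost_tick, List.length_cons]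
    split_ifs <;> simp only [cost_pure] <;> linarith

/-- As the skyline is not empty, the cost of drawing the sample is absorbed by that of the scans.
-/
lemma cost_verifyError_le (I : Input d) (row : ℕ → Fin I.n) {sky : List (Tuple d ℝ)}
    (hsky : 0 < sky.length) :
    (verifyError I row sky).cost ≤ 9 + (d + 4) * (verifySize I * sky.length) := by
  have h := cost_countUncovered_le sky (draw I.T row 0 (verifySize I)).val
  rw [length_draw] at h
  have h' := Nat.mul_le_mul_left (verifySize I) (Nat.succ_le_of_lt hsky)
  simp only [verifyError, cost_bind, cost_tick, cost_draw, cost_pure]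
  linarith

/-! ### The rounds together -/

variable (I : Input d) (ω : Draws I.n)

lemma sampleSize_eq (k : ℕ) : sampleSize I ω k = 2 ^ k * I.sI := by
  induction k with
  | zero => simp [sampleSize, exec, initRound]
  | succ k ih =>
    have h : sampleSize I ω (k + 1) = 2 * sampleSize I ω k := by
      simp [sampleSize, exec, loopBody]
    rw [h, ih]; ring

lemma approxSky_zero : approxSky I ω 0 = (getSkyline (draw I.T ω.S 0 I.sI).val).val := rfl

lemma approxSky_succ (k : ℕ) : approxSky I ω (k + 1) =
    (mergeSkyline (approxSky I ω k)
      (getSkyline (draw I.T ω.S (sampleSize I ω k) (sampleSize I ω k)).val).val).val := rfl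

lemma length_approxSky_le (k : ℕ) : (approxSky I ω k).length ≤ sampleSize I ω k := by
  induction k with
  | zero =>
    rw [approxSky_zero, sampleSize_eq]
    simpa using length_getSkyline_le (draw I.T ω.S 0 I.sI).val
  | succ k ih =>
    have h := length_getSkyline_le (draw I.T ω.S (sampleSize I ω k) (sampleSize I ω k)).val
    rw [length_draw] at h
    rw [approxSky_succ]
    refine (length_mergeSkyline_le _ _).trans ?_
    have h2 : sampleSize I ω (k + 1) = 2 * sampleSize I ω k := by
      rw [sampleSize_eq, sampleSize_eq]; ring
    omega

lemma length_approxSky_pos (hI : 1 ≤ I.sI) (k : ℕ) : 0 < (approxSky I ω k).length := by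
  induction k with
  | zero => exact length_getSkyline_pos (by rw [length_draw]; exact hI)
  | succ k ih => exact length_mergeSkyline_pos ih

lemma sum_length_approxSky_le (k : ℕ) :
    ∑ j ∈ Finset.range (k + 1), (approxSky I ω j).length ≤ 2 * sampleSize I ω k := by
  induction k with
  | zero => have := length_approxSky_le I ω 0; simp; omega
  | succ k ih =>
    rw [Finset.sum_range_succ]
    have h := length_approxSky_le I ω (k + 1)
    have h2 : sampleSize I ω (k + 1) = 2 * sampleSize I ω k := by
      rw [sampleSize_eq, sampleSize_eq]; ring
    omega

/-- The sample sizes double, so the skyline computations of all rounds together cost at most twice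
as much as those of the last round. -/
lemma exists_cost_exec_le (d : ℕ) (hd : 2 ≤ d) :
    ∃ c : ℕ, ∀ (I : Input d) (ω : Draws I.n) (k M : ℕ), 1 ≤ I.sI → sampleSize I ω k ≤ M →
      (exec I ω k).cost ≤ c * (2 * sampleSize I ω k * (Nat.clog 2 M + 1) ^ (d - 1)) +
        (d + 4) * (verifySize I * ∑ j ∈ Finset.range (k + 1), (approxSky I ω j).length) := by
  obtain ⟨c, hc⟩ := exists_cost_getSkyline_le d hd
  refine ⟨5 * c + 13, fun I ω k M hI => ?_⟩
  have hG : 1 ≤ (Nat.clog 2 M + 1) ^ (d - 1) := Nat.one_le_iff_ne_zero.2 (by positivity)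
  induction k with
  | zero =>
    intro hM
    have hv := cost_verifyError_le I (ω.V 0) (length_approxSky_pos I ω hI 0)
    rw [approxSky_zero] at hv
    rw [sampleSize_eq, pow_zero, one_mul] at hM ⊢
    have hs := hc (draw I.T ω.S 0 I.sI).val M (by simpa using hM)
    rw [length_draw] at hs
    simp only [exec, initRound, cost_bind, cost_tick, cost_draw, cost_pure, zero_add,
      Finset.sum_range_one, approxSky_zero]
    generalize (Nat.clog 2 M + 1) ^ (d - 1) = G at *
    have h₁ : I.sI ≤ I.sI * G := Nat.le_mul_of_pos_right _ hG
    have h₂ : G ≤ I.sI * G := Nat.le_mul_of_pos_left _ hI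
    have h₃ := Nat.mul_le_mul_left c h₂
    have h₄ : 0 ≤ c * (I.sI * G) := Nat.zero_le _
    linarith
  | succ k ih =>
    intro hM
    have h2 : sampleSize I ω (k + 1) = 2 * sampleSize I ω k := by
      rw [sampleSize_eq, sampleSize_eq]; ring
    have hm : 1 ≤ sampleSize I ω k := by
      rw [sampleSize_eq]; exact Nat.one_le_iff_ne_zero.2 (by positivity)
    have ih := ih (by omega)
    have hv := cost_verifyError_le I (ω.V (k + 1)) (length_approxSky_pos I ω hI (k + 1))
    have hsky := length_approxSky_le I ω k
    have hnew := length_getSkyline_le (draw I.T ω.S (sampleSize I ω k) (sampleSize I ω k)).val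
    have hs := hc (draw I.T ω.S (sampleSize I ω k) (sampleSize I ω k)).val M
      (by rw [length_draw]; omega)
    have hg := hc (approxSky I ω k ++
      (getSkyline (draw I.T ω.S (sampleSize I ω k) (sampleSize I ω k)).val).val) M
      (by rw [List.length_append]; rw [length_draw] at hnew; omega)
    have hcost : (exec I ω (k + 1)).cost = (exec I ω k).cost + (1 + (sampleSize I ω k +
        ((getSkyline (draw I.T ω.S (sampleSize I ω k) (sampleSize I ω k)).val).cost +
        (((approxSky I ω k).length + (getSkyline (approxSky I ω k ++
          (getSkyline (draw I.T ω.S (sampleSize I ω k) (sampleSize I ω k)).val).val)).cost) +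
        (verifyError I (ω.V (k + 1)) (approxSky I ω (k + 1))).cost))) + 1) := by
      rw [approxSky_succ]
      simp only [exec, loopBody, mergeSkyline, cost_bind, val_bind, cost_tick, cost_draw,
        cost_pure, cost_appendT, val_appendT, add_zero, sampleSize, approxSky]
    rw [hcost, Finset.sum_range_succ, h2]
    rw [List.length_append] at hg
    rw [length_draw] at hs hnew
    generalize (Nat.clog 2 M + 1) ^ (d - 1) = G at *
    generalize sampleSize I ω k = m at *
    have h₁ : m ≤ m * G := Nat.le_mul_of_pos_right _ hG
    have h₂ := Nat.mul_le_mul_left c (Nat.le_mul_of_pos_left G hm)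
    have h₃ := hg.trans (Nat.mul_le_mul_left c (Nat.mul_le_mul_right G
      (Nat.add_le_add_right (Nat.add_le_add hsky hnew) 1)))
    have h₄ : 0 ≤ c * (m * G) := Nat.zero_le _
    linarith

lemma logTerm_nonneg {I : Input d} (hI : I.Valid) : 0 ≤ logTerm I := by
  obtain ⟨hn, -, hδ, hδ', -⟩ := hI
  have h₁ : (1 : ℝ) ≤ Real.logb 2 I.n := by
    rw [Real.le_logb_iff_rpow_le (by norm_num) (by positivity)]
    simpa using (by exact_mod_cast hn : (2 : ℝ) ≤ I.n)
  exact add_nonneg (Real.log_nonneg h₁)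
    (Real.log_nonneg (by rw [le_div_iff₀ hδ]; linarith))

lemma verifySize_le {I : Input d} (hI : I.Valid) :
    (verifySize I : ℝ) ≤ 18 * logTerm I / I.ε + 1 := by
  have hε := hI.2.1
  have hΛ := logTerm_nonneg hI
  exact (Nat.ceil_lt_add_one (by positivity)).le

lemma one_le_logb_of_two_le {m : ℕ} (hm : 2 ≤ m) : (1 : ℝ) ≤ Real.logb 2 m := by
  rw [Real.le_logb_iff_rpow_le (by norm_num) (by positivity)]
  simpa using (by exact_mod_cast hm : (2 : ℝ) ≤ m)

lemma clog_add_one_le {m : ℕ} (hm : 2 ≤ m) : ((Nat.clog 2 m + 1 : ℕ) : ℝ) ≤ 3 * Real.logb 2 m := by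
  have h₁ := one_le_logb_of_two_le hm
  have h₂ : (Nat.clog 2 m : ℝ) < Real.logb 2 m + 1 := by
    rw [← Real.natCeil_logb_natCast]
    exact Nat.ceil_lt_add_one (by push_cast; linarith)
  push_cast
  linarith

lemma rounds_le {I : Input d} {ω : Draws I.n} {k : ℕ} (hI : 1 ≤ I.sI) :
    (k : ℝ) ≤ Real.logb 2 (sampleSize I ω k) := by
  have h : 2 ^ k ≤ sampleSize I ω k := by
    rw [sampleSize_eq]; exact Nat.le_mul_of_pos_right _ hI
  have h0 : (0 : ℝ) < sampleSize I ω k := by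
    exact_mod_cast lt_of_lt_of_le (by positivity) h
  rw [Real.le_logb_iff_rpow_le (by norm_num) h0, Real.rpow_natCast]
  exact_mod_cast h

/-- The running time splits into the skyline computations and the scans of the verified skylines.
-/
lemma exists_runTime_le (d : ℕ) (hd : 2 ≤ d) :
    ∃ c : ℝ, 0 < c ∧ ∀ (I : Input d) (ω : Draws I.n) (k m : ℕ), I.Valid →
      m = sampleSize I ω k → 2 ≤ m →
      (runTime I ω k : ℝ) ≤ c * (m * Real.logb 2 m ^ (d - 1)) +
        (d + 4) * (18 * logTerm I / I.ε *
          ∑ j ∈ Finset.range (k + 1), ((approxSky I ω j).length : ℝ)) := by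
  obtain ⟨c, hc⟩ := exists_cost_exec_le d hd
  refine ⟨c * 2 * 3 ^ (d - 1) + 2 * (d + 4) + 1, by positivity, ?_⟩
  rintro I ω k m hI rfl hm
  have h := hc I ω k _ hI.2.2.2.2 le_rfl
  have hS := sum_length_approxSky_le I ω k
  have hS0 : (0 : ℝ) ≤ ∑ j ∈ Finset.range (k + 1), ((approxSky I ω j).length : ℝ) := by
    positivity
  have hv := verifySize_le hI
  have hclog := clog_add_one_le hm
  have hL := one_le_logb_of_two_le hm
  generalize sampleSize I ω k = m at *
  have hm' : (2 : ℝ) ≤ m := by exact_mod_cast hm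
  have h' : ((exec I ω k).cost : ℝ) ≤
      c * (2 * m * ((Nat.clog 2 m + 1 : ℕ) : ℝ) ^ (d - 1)) + (d + 4) * (verifySize I *
        ∑ j ∈ Finset.range (k + 1), ((approxSky I ω j).length : ℝ)) := by
    exact_mod_cast h
  have hS' : ∑ j ∈ Finset.range (k + 1), ((approxSky I ω j).length : ℝ) ≤ 2 * m := by
    exact_mod_cast hS
  have hpow : ((Nat.clog 2 m + 1 : ℕ) : ℝ) ^ (d - 1) ≤ 3 ^ (d - 1) * Real.logb 2 m ^ (d - 1) := by
    rw [← mul_pow]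
    gcongr
  have h₁ : (c : ℝ) * (2 * m * ((Nat.clog 2 m + 1 : ℕ) : ℝ) ^ (d - 1)) ≤
      c * (2 * m * (3 ^ (d - 1) * Real.logb 2 m ^ (d - 1))) := by gcongr
  have h₂ : (m : ℝ) ≤ m * Real.logb 2 m ^ (d - 1) :=
    le_mul_of_one_le_right (by positivity) (one_le_pow₀ hL)
  -- The rounding in `verifySize` costs one scan of every verified skyline, at most `2 * m` tuples.
  have h₃ : (d + 4 : ℝ) * (verifySize I *
      ∑ j ∈ Finset.range (k + 1), ((approxSky I ω j).length : ℝ)) ≤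
      (d + 4) * (18 * logTerm I / I.ε *
        ∑ j ∈ Finset.range (k + 1), ((approxSky I ω j).length : ℝ) + 2 * m) := by
    gcongr
    calc _ ≤ (18 * logTerm I / I.ε + 1) *
          ∑ j ∈ Finset.range (k + 1), ((approxSky I ω j).length : ℝ) := by gcongr
      _ ≤ _ := by rw [add_mul, one_mul]; gcongr
  have h₄ : (d + 4 : ℝ) * (2 * m) ≤ (d + 4) * (2 * (m * Real.logb 2 m ^ (d - 1))) := by gcongr
  simp only [runTime]
  push_cast
  linarith

end Sky

end Skyline

theorem mainTheorem9 (d : ℕ) (hd : 2 ≤ d) :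
    (∀ ε : ℝ, ∃ C : ℝ, 0 < C ∧
      ∀ (I : Skyline.Input d) (ω : Skyline.Draws I.n) (k m : ℕ),
        I.Valid → I.ε = ε → Skyline.ReturnsAfter I ω k → m = Skyline.sampleSize I ω k → 2 ≤ m →
        (Skyline.runTime I ω k : ℝ) ≤
          C * ((m : ℝ) * Real.logb 2 m ^ (d - 1) +
            (Real.log (Real.logb 2 I.n) + Real.log (1 / I.δ)) * m * Real.logb 2 m)) ∧
    (∃ C : ℝ, 0 < C ∧
      ∀ (I : Skyline.Input d) (ω : Skyline.Draws I.n) (k m : ℕ) (K : ℝ),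
        I.Valid → Skyline.ReturnsAfter I ω k → m = Skyline.sampleSize I ω k → 2 ≤ m →
        (∀ j ≤ k, ((Skyline.approxSky I ω j).length : ℝ) ≤ K * I.ε * m) →
        (Skyline.runTime I ω k : ℝ) ≤
          C * ((m : ℝ) * Real.logb 2 m ^ (d - 1) +
            K * (Real.log (Real.logb 2 I.n) + Real.log (1 / I.δ)) * m * Real.logb 2 m)) := by
  obtain ⟨c, hc0, hc⟩ := Skyline.exists_runTime_le d hd
  constructor
  · intro ε
    -- The absolute value keeps the constant positive when no valid input has error bound `ε`.
    refine ⟨c + (d + 4) * (36 / |ε|), by positivity, ?_⟩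
    rintro I ω k m hI rfl - hm hm2
    have h := hc I ω k m hI hm hm2
    have hε : 0 < I.ε := hI.2.1
    have hΛ := Skyline.logTerm_nonneg hI
    have hL := Skyline.one_le_logb_of_two_le hm2
    have hS : ∑ j ∈ Finset.range (k + 1), ((Skyline.approxSky I ω j).length : ℝ) ≤ 2 * m := by
      rw [hm]; exact_mod_cast Skyline.sum_length_approxSky_le I ω k
    rw [abs_of_pos hε]
    change _ ≤ _ * (_ + Skyline.logTerm I * m * _)
    generalize Skyline.logTerm I = Λ at *
    have h₁ : 18 * Λ / I.ε * ∑ j ∈ Finset.range (k + 1), ((Skyline.approxSky I ω j).length : ℝ) ≤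
        36 / I.ε * (Λ * m * Real.logb 2 m) := by
      calc _ ≤ 18 * Λ / I.ε * (2 * m) := by gcongr
        _ = 36 / I.ε * (Λ * m * 1) := by ring
        _ ≤ _ := by gcongr
    have h₂ : (d + 4 : ℝ) * _ ≤ _ := mul_le_mul_of_nonneg_left h₁ (by positivity)
    have h₃ : 0 ≤ c * (Λ * m * Real.logb 2 m) := by positivity
    have h₄ : 0 ≤ (d + 4) * (36 / I.ε) * (m * Real.logb 2 m ^ (d - 1)) := by positivity
    linarith
  · refine ⟨c + 36 * (d + 4), by positivity, ?_⟩
    rintro I ω k m K hI - hm hm2 hK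
    have h := hc I ω k m hI hm hm2
    have hε : 0 < I.ε := hI.2.1
    have hΛ := Skyline.logTerm_nonneg hI
    have hL := Skyline.one_le_logb_of_two_le hm2
    have hk : (k : ℝ) ≤ Real.logb 2 m := hm ▸ Skyline.rounds_le hI.2.2.2.2
    -- The verified skylines are not empty, so `K` is positive.
    have hK0 : 0 < K := by
      have h₁ : (0 : ℝ) < (Skyline.approxSky I ω 0).length := by
        exact_mod_cast Skyline.length_approxSky_pos I ω hI.2.2.2.2 0
      have h₂ : 0 < K * (I.ε * m) := by
        rw [← mul_assoc]; exact h₁.trans_le (hK 0 (Nat.zero_le k))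
      exact pos_of_mul_pos_left h₂ (by positivity)
    have hS : ∑ j ∈ Finset.range (k + 1), ((Skyline.approxSky I ω j).length : ℝ) ≤
        (k + 1) * (K * I.ε * m) := by
      calc _ ≤ ∑ _j ∈ Finset.range (k + 1), K * I.ε * m :=
            Finset.sum_le_sum fun j hj => hK j (Nat.lt_succ_iff.1 (Finset.mem_range.1 hj))
        _ = _ := by simp
    change _ ≤ _ * (_ + K * Skyline.logTerm I * m * _)
    generalize Skyline.logTerm I = Λ at *
    have h₁ : 18 * Λ / I.ε * ∑ j ∈ Finset.range (k + 1), ((Skyline.approxSky I ω j).length : ℝ) ≤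
        36 * (K * Λ * m * Real.logb 2 m) := by
      calc _ ≤ 18 * Λ / I.ε * ((k + 1) * (K * I.ε * m)) := by gcongr
        _ = 18 * (K * Λ * m * (k + 1)) := by field_simp
        _ ≤ 18 * (K * Λ * m * (2 * Real.logb 2 m)) := by gcongr; linarith
        _ = _ := by ring
    have h₂ : (d + 4 : ℝ) * _ ≤ _ := mul_le_mul_of_nonneg_left h₁ (by positivity)
    have h₃ : 0 ≤ c * (K * Λ * m * Real.logb 2 m) := by positivity
    have h₄ : 0 ≤ 36 * (d + 4) * (m * Real.logb 2 m ^ (d - 1)) := by positivity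
    linarith
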